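/- Let $(S,*)$ be a finite cycle set (a finite set with a binary operation such that every map $\psi(s)\colon t\mapsto s*t$ is bijective and $(s*t)*(s*u)=(t*s)*(t*u)$ for all $s,t,u$). Let $G=\langle S\mid s(s*t)=t(t*s),\ s\neq t\rangle$ be its structure group, equipped with its brace structure $(G,+,\cdot)$, for which $(G,+)$ is free abelian on $S$ and $\lambda_s^{-1}(t)=s*t$, where $\lambda_a(b)=ab-a$. Write $s^{[k]}=ks$ for the $k$-fold sum of $s$, let $d$ be Dehornoy's class of $S$ (the smallest positive integer with $\lambda_{s^{[d]}}=\mathrm{id}$ for all $s\in S$), and for $l\ge 1$ let $\overline G_l=G/\langle s^{[ld]}\rangle_{s\in S}$. For a commutative ring $R$ and a polynomial $P\in R[X]$ put $\mathcal H(S,P)=R[G]/J_P$, where $J_P$ is the two-sided ideal generated by the elements $P(s^{[d]})$, $s\in S$. For $g\in\overline G_l$ let $T_g\in\mathcal H(S,P)$ be the image of the unique element $\sum_{s} g_s s$ of $G$ above $g$ with $0\le g_s<ld$ for all $s$ (equivalently, the product of the generators along any reduced expression of $g$). An anti-involution of a ring is an additive map $f$ with $f(xy)=f(y)f(x)$ and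 $f(f(x))=x$. (1) Let $P$ have degree $l>0$ and invertible leading coefficient $a_l$, and suppose that $P=a_l\prod_{i=1}^l(X-\alpha_i)$ with $\alpha_1,\dots,\alpha_l\in R$ invertible (not necessarily distinct). Let $\iota\colon R\to R$ be an anti-involution with $\iota(\alpha_i)=\alpha_i^{-1}$ for all $i$. Then there is an anti-involution $\tilde\iota$ of $\mathcal H(S,P)$ that extends $\iota$, i.e. $\tilde\iota(r\cdot 1)=\iota(r)\cdot 1$ for all $r\in R$, and such that for every $g\in\overline G_l$ the element $T_g$ is invertible and $\tilde\iota(T_g)=T_g^{-1}$. (2) In the generic case, that is over $R[q^{\pm1}]$ with $P(X)=X^2-(q-1)X-q$ (and $l=2$), the $R$-algebra involution $q\mapsto q^{-1}$ of $R[q^{\pm1}]$ extends in this sense to an anti-involution of $\mathcal H(S,P)$ with $T_g\mapsto T_g^{-1}$ for all $g\in\overline G_2$. -/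

import Mathlib

open Polynomial

/-- A (left) cycle set: left multiplications are bijective and
`(s * t) * (s * u) = (t * s) * (t * u)`. -/
class CycleSet (S : Type*) where
  /-- the binary operation `s * t` -/
  op : S → S → S
  bijective_op : ∀ s, Function.Bijective (op s)
  op_op : ∀ s t u, op (op s t) (op s u) = op (op t s) (op t u)

namespace CycleSet

section StructureGroup

variable {S : Type*} [CycleSet S]

/-- The permutation `ψ(s) : t ↦ s * t`. -/
noncomputable def psi (s : S) : Equiv.Perm S := Equiv.ofBijective (op s) (bijective_op s)

/-- The diagonal map `s ↦ s * s`. -/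
def diag (s : S) : S := op s s

variable (S) in
/-- The relations `s (s * t) = t (t * s)`, `s ≠ t`. -/
def rels : Set (FreeGroup S) :=
  {r | ∃ s t : S, s ≠ t ∧
    r = (FreeGroup.of s * FreeGroup.of (op s t)) * (FreeGroup.of t * FreeGroup.of (op t s))⁻¹}

variable (S) in
/-- The structure group `G = ⟨S ∣ s (s * t) = t (t * s)⟩`. -/
abbrev StructureGroup : Type _ := PresentedGroup (rels S)

/-- The generator of the structure group attached to `s`. -/
def gen (s : S) : StructureGroup S := PresentedGroup.of s

theorem psi_apply (s t : S) : psi s t = op s t := rfl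

theorem psi_psi (s t : S) : psi (op s t) * psi s = psi (op t s) * psi t :=
  Equiv.ext fun u => op_op s t u

theorem gen_rel (s t : S) : gen s * gen (op s t) = gen t * gen (op t s) := by
  by_cases h : s = t
  · rw [h]
  · have := PresentedGroup.one_of_mem (rels := rels S) ⟨s, t, h, rfl⟩
    rw [map_mul, map_inv, mul_inv_eq_one] at this
    rw [map_mul, map_mul] at this
    exact this

theorem lift_rels {H : Type*} [Group H] (f : S → H)
    (hf : ∀ s t, f s * f (op s t) = f t * f (op t s)) :
    ∀ r ∈ rels S, FreeGroup.lift f r = 1 := by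
  rintro r ⟨s, t, -, rfl⟩
  simp [hf s t]

/-- The morphism `λ` from the structure group to the permutations of `S`, `λ_s = ψ(s)⁻¹`. It gives
the action of `G` on `ℤ^S` by permutation of the coordinates, `λ_g (∑ v_s s) = ∑ v_s λ_g(s)`. -/
noncomputable def lam : StructureGroup S →* Equiv.Perm S :=
  PresentedGroup.toGroup (f := fun s => (psi s)⁻¹) (lift_rels _ fun s t => by
    rw [← mul_inv_rev, ← mul_inv_rev, psi_psi])

theorem lam_gen (s : S) : lam (gen s) = (psi s)⁻¹ := PresentedGroup.toGroup.of _

open Classical in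
/-- The basis vector of `ℤ^S` attached to `s`. -/
noncomputable def basisVec (s : S) : S → ℤ := Pi.single s 1

theorem basisVec_comp (s : S) (σ : Equiv.Perm S) : basisVec (σ s) ∘ σ = basisVec s := by
  classical
  funext t
  simp [basisVec, Pi.single_apply]

/-- The affine bijection `v ↦ s + λ_s(v)` of `ℤ^S`. -/
noncomputable def affineGen (s : S) : Equiv.Perm (S → ℤ) where
  toFun v := basisVec s + v ∘ psi s
  invFun v := (v - basisVec s) ∘ (psi s).symm
  left_inv v := by funext t; simp
  right_inv v := by funext t; simp

/-- The action of the structure group on `ℤ^S` by affine bijections, `g · v = cp(g) + λ_g(v)`. -/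
noncomputable def affine : StructureGroup S →* Equiv.Perm (S → ℤ) :=
  PresentedGroup.toGroup (f := affineGen) (lift_rels _ fun s t => by
    ext1 v
    have h : ∀ a b : S, (affineGen a * affineGen (op a b)) v
        = basisVec a + basisVec b + v ∘ (psi (op a b) * psi a) := by
      intro a b
      have := basisVec_comp b (psi a)
      rw [psi_apply] at this
      change basisVec a + (basisVec (op a b) + v ∘ psi (op a b)) ∘ psi a = _
      rw [add_assoc, ← this]
      rfl
    rw [h, h, psi_psi, add_comm (basisVec s)])

/-- The bijective 1-cocycle `cp : G → ℤ^S`, characterised by `cp(s) = s` for `s ∈ S` and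
`cp(gh) = cp(g) + λ_g(cp(h))`. -/
noncomputable def cp (g : StructureGroup S) : S → ℤ := affine g 0

@[elab_as_elim]
theorem induction_right {p : StructureGroup S → Prop} (one : p 1)
    (mul : ∀ g s, p g → p (g * gen s)) (mul_inv : ∀ g s, p g → p (g * (gen s)⁻¹))
    (g : StructureGroup S) : p g := by
  have h : ∀ x : FreeGroup S, ∀ g, p g → p (g * PresentedGroup.mk (rels S) x) := by
    intro x
    induction x using FreeGroup.induction_on with
    | C1 => intro g hg; simpa using hg
    | of s => exact fun g hg => mul g s hg
    | inv_of s _ => exact fun g hg => mul_inv g s hg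
    | mul x y hx hy => intro g hg; rw [map_mul, ← mul_assoc]; exact hy _ (hx _ hg)
  obtain ⟨x, rfl⟩ := PresentedGroup.mk_surjective (rels S) g
  simpa using h x 1 one

theorem affine_gen (s : S) : affine (gen s) = affineGen s := PresentedGroup.toGroup.of _

theorem cp_gen (s : S) : cp (gen s) = basisVec s := by
  rw [cp, affine_gen]
  change basisVec s + (0 : S → ℤ) ∘ psi s = _
  funext t; simp

theorem affine_add (g : StructureGroup S) (v w : S → ℤ) :
    affine g (v + w) = affine g v + w ∘ ⇑(lam g)⁻¹ := by
  induction g using induction_right generalizing v w with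
  | one => simp
  | mul g s ih =>
    rw [map_mul, map_mul, Equiv.Perm.mul_apply, Equiv.Perm.mul_apply, affine_gen]
    have : affineGen s (v + w) = affineGen s v + w ∘ psi s := by
      change basisVec s + (v + w) ∘ psi s = basisVec s + v ∘ psi s + w ∘ psi s
      rw [add_assoc]; rfl
    rw [this, ih, mul_inv_rev, lam_gen, inv_inv]
    rfl
  | mul_inv g s ih =>
    rw [map_mul, map_mul, Equiv.Perm.mul_apply, Equiv.Perm.mul_apply, map_inv, affine_gen]
    have : (affineGen s)⁻¹ (v + w) = (affineGen s)⁻¹ v + w ∘ (psi s).symm := by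
      change (v + w - basisVec s) ∘ (psi s).symm = (v - basisVec s) ∘ (psi s).symm + _
      funext t; simp; ring
    rw [this, ih, map_inv, mul_inv_rev, lam_gen, inv_inv]
    rfl

theorem cp_mul (g h : StructureGroup S) : cp (g * h) = cp g + cp h ∘ ⇑(lam g)⁻¹ := by
  rw [cp, map_mul, Equiv.Perm.mul_apply, ← zero_add (affine h 0), affine_add]
  rfl

theorem cp_one : cp (1 : StructureGroup S) = 0 := by simp [cp]

/-- The product `s T(s) ⋯ T^{k-1}(s)`, where `T` is the diagonal map. -/
def diagProd (s : S) : ℕ → StructureGroup S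
  | 0 => 1
  | k + 1 => diagProd s k * gen (diag^[k] s)

theorem lam_diagProd (s : S) (k : ℕ) : (lam (diagProd s k))⁻¹ s = diag^[k] s := by
  induction k with
  | zero => simp [diagProd]
  | succ k ih =>
    rw [diagProd, map_mul, mul_inv_rev, Equiv.Perm.mul_apply, ih, lam_gen, inv_inv,
      Function.iterate_succ_apply']
    rfl

theorem cp_mul_gen (g : StructureGroup S) (s : S) :
    cp (g * gen ((lam g)⁻¹ s)) = cp g + basisVec s := by
  rw [cp_mul, cp_gen, basisVec_comp]

theorem cp_diagProd (s : S) (k : ℕ) : cp (diagProd s k) = k • basisVec s := by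
  induction k with
  | zero => simp [diagProd, cp_one]
  | succ k ih => rw [diagProd, ← lam_diagProd, cp_mul_gen, ih, succ_nsmul]

theorem diagProd_add (s : S) (i j : ℕ) :
    diagProd s (i + j) = diagProd s i * diagProd (diag^[i] s) j := by
  induction j with
  | zero => simp [diagProd]
  | succ j ih =>
    rw [← add_assoc, diagProd, ih, diagProd, mul_assoc, ← Function.iterate_add_apply, add_comm j i]

theorem gen_mul_diagProd (u v : S) (k : ℕ) :
    gen v * diagProd (op v u) k = diagProd u k * gen ((lam (diagProd u k))⁻¹ v) := by
  induction k with
  | zero => simp [diagProd]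
  | succ k ih =>
    set w := (lam (diagProd u k))⁻¹ v with hw
    have h1 : diag^[k] (op v u) = op w (diag^[k] u) := by
      have h2 := congrArg (fun g => (lam g)⁻¹ u) ih
      simp only [map_mul, mul_inv_rev, Equiv.Perm.mul_apply, lam_gen, inv_inv,
        lam_diagProd, psi_apply] at h2
      exact h2
    rw [diagProd, ← mul_assoc, ih, h1, mul_assoc, gen_rel w, diagProd, mul_assoc, map_mul,
      mul_inv_rev, Equiv.Perm.mul_apply, ← hw, lam_gen, inv_inv]
    rfl

theorem exists_lam_diagProd [Finite S] (s : S) : ∃ k, 0 < k ∧ lam (diagProd s k) = 1 := by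
  have stable : ∀ u v : S, (∃ k, 0 < k ∧ lam (diagProd u k) = 1) →
      ∃ k, 0 < k ∧ lam (diagProd (psi v u) k) = 1 := by
    rintro u v ⟨k, hk, h⟩
    refine ⟨k, hk, ?_⟩
    have := congrArg lam (gen_mul_diagProd u v k)
    rw [h, map_mul, map_mul, h, one_mul, inv_one, Equiv.Perm.one_apply] at this
    exact mul_eq_left.mp this
  have back : ∀ u v : S, (∃ k, 0 < k ∧ lam (diagProd (psi v u) k) = 1) →
      ∃ k, 0 < k ∧ lam (diagProd u k) = 1 := by
    intro u v h
    have key : ∀ n : ℕ, ∃ k, 0 < k ∧ lam (diagProd (((psi v) ^ n) (psi v u)) k) = 1 := by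
      intro n
      induction n with
      | zero => simpa using h
      | succ n ih => rw [pow_succ']; exact stable _ v ih
    have h1 := key (orderOf (psi v) - 1)
    have h2 : ((psi v) ^ (orderOf (psi v) - 1)) (psi v u) = u := by
      rw [← Equiv.Perm.mul_apply, ← pow_succ, Nat.sub_add_cancel (orderOf_pos _), pow_orderOf_eq_one,
        Equiv.Perm.one_apply]
    rwa [h2] at h1
  have iter : ∀ i : ℕ, (∃ k, 0 < k ∧ lam (diagProd (diag^[i] s) k) = 1) →
      ∃ k, 0 < k ∧ lam (diagProd s k) = 1 := by
    intro i
    induction i with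
    | zero => exact id
    | succ i ih =>
      intro h
      rw [Function.iterate_succ_apply'] at h
      exact ih (back _ _ h)
  obtain ⟨i, j, hij, h⟩ := Finite.exists_ne_map_eq_of_infinite fun k => lam (diagProd s k)
  wlog hlt : i < j generalizing i j
  · exact this j i hij.symm h.symm (by omega)
  refine iter i ⟨j - i, by omega, ?_⟩
  have := diagProd_add s i (j - i)
  rw [Nat.add_sub_cancel' hlt.le] at this
  simp only [this, map_mul] at h
  exact left_eq_mul.mp h

theorem diag_bijective [Finite S] : Function.Bijective (diag : S → S) := by
  refine Function.Surjective.bijective_of_finite fun s => ?_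
  obtain ⟨k, hk, h⟩ := exists_lam_diagProd s
  have := lam_diagProd s k
  rw [h, inv_one, Equiv.Perm.one_apply] at this
  obtain ⟨m, rfl⟩ := Nat.exists_eq_succ_of_ne_zero hk.ne'
  rw [Function.iterate_succ_apply'] at this
  exact ⟨_, this.symm⟩

/-- The bijection `g ↦ g + s = g λ_g⁻¹(s)` of the structure group. -/
noncomputable def addGen [Finite S] (s : S) : Equiv.Perm (StructureGroup S) :=
  Equiv.ofBijective (fun g => g * gen ((lam g)⁻¹ s)) <| by
    constructor
    · intro g h e
      have e' := congrArg (fun x => (lam x)⁻¹ s) e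
      simp only [map_mul, mul_inv_rev, Equiv.Perm.mul_apply, lam_gen, inv_inv] at e'
      have := diag_bijective.1 e'
      dsimp only at e
      rwa [this, mul_left_inj] at e
    · intro h
      obtain ⟨x, hx⟩ := diag_bijective.2 ((lam h)⁻¹ s)
      refine ⟨h * (gen x)⁻¹, ?_⟩
      have : (lam (h * (gen x)⁻¹))⁻¹ s = x := by
        rw [map_mul, map_inv, mul_inv_rev, Equiv.Perm.mul_apply, ← hx, lam_gen, inv_inv,
          Equiv.Perm.inv_eq_iff_eq]
        rfl
      simp only [this, inv_mul_cancel_right]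

theorem addGen_apply [Finite S] (s : S) (g : StructureGroup S) :
    addGen s g = g * gen ((lam g)⁻¹ s) := rfl

theorem addGen_commute [Finite S] (s t : S) : Commute (addGen s) (addGen t) := by
  ext1 g
  simp only [Equiv.Perm.mul_apply, addGen_apply, map_mul, mul_inv_rev, lam_gen, inv_inv, psi_apply,
    mul_assoc]
  rw [gen_rel]

theorem cp_bijective [Finite S] : Function.Bijective (cp : StructureGroup S → S → ℤ) := by
  classical
  have := Fintype.ofFinite S
  -- the action of `ℤ^S` on `G` by addition
  have hΦ : Pairwise fun s t : S => ∀ x y : Multiplicative ℤ,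
      Commute (zpowersHom (Equiv.Perm (StructureGroup S)) (addGen s) x)
        (zpowersHom (Equiv.Perm (StructureGroup S)) (addGen t) y) := by
    intro s t _ x y
    simp only [zpowersHom_apply]
    exact (addGen_commute s t).zpow_zpow _ _
  let Φ : (S → Multiplicative ℤ) →* Equiv.Perm (StructureGroup S) :=
    MonoidHom.noncommPiCoprod (fun s => zpowersHom _ (addGen s)) hΦ
  let Q : (S → ℤ) → StructureGroup S := fun v => Φ (fun s => Multiplicative.ofAdd (v s)) 1
  have hQ : ∀ v s, Q (v + basisVec s) = addGen s (Q v) := by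
    intro v s
    have h1 : (fun t => Multiplicative.ofAdd ((v + basisVec s) t))
        = Pi.mulSingle s (Multiplicative.ofAdd 1) * fun t => Multiplicative.ofAdd (v t) := by
      funext t
      by_cases h : t = s
      · subst h
        simp [basisVec, mul_comm]
      · simp [basisVec, h]
    have h2 : Φ (Pi.mulSingle s (Multiplicative.ofAdd 1)) = addGen s := by
      have := MonoidHom.noncommPiCoprod_mulSingle (ϕ := fun s => zpowersHom _ (addGen s))
        (hcomm := hΦ) s (Multiplicative.ofAdd (1 : ℤ))
      refine this.trans ?_
      simp
    change Φ _ 1 = addGen s (Φ _ 1)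
    rw [h1, map_mul, Equiv.Perm.mul_apply, h2]
  have left : ∀ g, Q (cp g) = g := by
    intro g
    induction g using induction_right with
    | one =>
      have : (fun s => Multiplicative.ofAdd ((0 : S → ℤ) s)) = 1 := rfl
      change Φ _ 1 = 1
      rw [cp_one, this, map_one Φ, Equiv.Perm.one_apply]
    | mul g s ih =>
      have := cp_mul_gen g (lam g s)
      rw [Equiv.Perm.coe_inv, Equiv.symm_apply_apply] at this
      rw [this, hQ, ih, addGen_apply, Equiv.Perm.coe_inv, Equiv.symm_apply_apply]
    | mul_inv g s ih =>
      set h := g * (gen s)⁻¹ with hh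
      have hg : g = h * gen s := by simp [hh]
      have := cp_mul_gen h (lam h s)
      rw [Equiv.Perm.coe_inv, Equiv.symm_apply_apply, ← hg] at this
      rw [this, hQ] at ih
      apply (addGen (lam h s)).injective
      rw [ih, addGen_apply, Equiv.Perm.coe_inv, Equiv.symm_apply_apply, hg]
  refine ⟨Function.LeftInverse.injective left, ?_⟩
  let K : AddSubgroup (S → ℤ) :=
    { carrier := {w | ∀ v, v ∈ Set.range (cp : StructureGroup S → S → ℤ) ↔ v + w ∈ Set.range cp}
      zero_mem' := fun v => by rw [add_zero]
      add_mem' := fun {a b} ha hb v => by rw [ha v, hb (v + a), add_assoc]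
      neg_mem' := fun {a} ha v => by rw [ha (v + -a), neg_add_cancel_right] }
  have hK : ∀ s, basisVec s ∈ K := by
    intro s v
    constructor
    · rintro ⟨g, rfl⟩
      exact ⟨_, cp_mul_gen g s⟩
    · rintro ⟨g, hg⟩
      obtain ⟨h, rfl⟩ := (addGen s).surjective g
      rw [addGen_apply, cp_mul_gen, add_left_inj] at hg
      exact ⟨h, hg⟩
  intro v
  have hv : v ∈ K := by
    rw [← Finset.univ_sum_single v]
    refine AddSubgroup.sum_mem _ fun s _ => ?_
    have : (Pi.single s (v s) : S → ℤ) = v s • basisVec s := by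
      rw [basisVec, ← Pi.single_smul, smul_eq_mul, mul_one]
    rw [this]
    exact AddSubgroup.zsmul_mem _ (hK s) _
  have := (hv 0).1 ⟨1, cp_one⟩
  rwa [zero_add] at this

/-- The bijective 1-cocycle `cp : G ≃ ℤ^S` as an equivalence; its inverse is denoted `Π`. The
structure group is a brace for its multiplication and the addition transported from `ℤ^S`. -/
noncomputable def cpEquiv [Finite S] : StructureGroup S ≃ (S → ℤ) := Equiv.ofBijective cp cp_bijective

/-- `s^{[k]} = k s`, the `k`-fold sum of `s` in the brace `G`. -/
noncomputable def bracket [Finite S] (s : S) (k : ℕ) : StructureGroup S :=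
  cpEquiv.symm (k • basisVec s)

theorem cp_bracket [Finite S] (s : S) (k : ℕ) : cp (bracket s k) = k • basisVec s :=
  cpEquiv.apply_symm_apply _

theorem bracket_eq_diagProd [Finite S] (s : S) (k : ℕ) : bracket s k = diagProd s k := by
  apply cp_bijective.1
  rw [cp_bracket, cp_diagProd]

theorem bracket_mul [Finite S] (s : S) (k m : ℕ) (h : lam (bracket s k) = 1) :
    bracket s (m * k) = bracket s k ^ m := by
  rw [bracket_eq_diagProd, bracket_eq_diagProd] at *
  have hk := lam_diagProd s k
  rw [h, inv_one, Equiv.Perm.one_apply] at hk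
  induction m with
  | zero => simp [diagProd]
  | succ m ih => rw [Nat.succ_mul, add_comm, diagProd_add, ← hk, ih, pow_succ']

variable (S) in
/-- The socle of the brace `G`, the kernel of `λ`. -/
noncomputable def socle : Subgroup (StructureGroup S) := lam.ker

variable (S) in
/-- Dehornoy's class: the smallest positive integer `d` such that `d s` lies in the socle of `G`
for all `s`. -/
noncomputable def dehornoyClass [Finite S] : ℕ :=
  sInf {d : ℕ | 0 < d ∧ ∀ s : S, bracket s d ∈ socle S}

variable (S) in
theorem dehornoyClass_spec [Finite S] :
    0 < dehornoyClass S ∧ ∀ s : S, bracket s (dehornoyClass S) ∈ socle S := by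
  refine Nat.sInf_mem (s := {d : ℕ | 0 < d ∧ ∀ s : S, bracket s d ∈ socle S}) ?_
  have := Fintype.ofFinite S
  choose k hk h using fun s : S => exists_lam_diagProd s
  refine ⟨∏ s, k s, Finset.prod_pos fun s _ => hk s, fun s => ?_⟩
  obtain ⟨m, hm⟩ := Finset.dvd_prod_of_mem k (Finset.mem_univ s)
  change lam _ = 1
  have h' : lam (bracket s (k s)) = 1 := by rw [bracket_eq_diagProd, h]
  rw [hm, mul_comm, bracket_mul _ _ _ h', map_pow, h', one_pow]

variable (S) in
/-- The germ `G̅_l`: the quotient of `G` by all the elements `s^{[ld]}`, `d` being Dehornoy's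
class. -/
abbrev Germ [Finite S] (l : ℕ) : Type _ :=
  StructureGroup S ⧸ Subgroup.normalClosure
    (Set.range fun s : S => bracket s (l * dehornoyClass S))

theorem cp_dvd [Finite S] (l : ℕ) {g : StructureGroup S}
    (hg : g ∈ Subgroup.normalClosure (Set.range fun s : S => bracket s (l * dehornoyClass S))) :
    ∀ s, ((l * dehornoyClass S : ℕ) : ℤ) ∣ cp g s := by
  let N : Subgroup (StructureGroup S) :=
    { carrier := {g | lam g = 1 ∧ ∀ s, ((l * dehornoyClass S : ℕ) : ℤ) ∣ cp g s}
      one_mem' := ⟨map_one _, fun s => by simp [cp_one]⟩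
      mul_mem' := by
        rintro a b ⟨ha, ha'⟩ ⟨hb, hb'⟩
        refine ⟨by rw [map_mul, ha, hb, one_mul], fun s => ?_⟩
        rw [cp_mul]
        exact dvd_add (ha' s) (hb' _)
      inv_mem' := by
        rintro a ⟨ha, ha'⟩
        refine ⟨by rw [map_inv, ha, inv_one], fun s => ?_⟩
        have := cp_mul a a⁻¹
        rw [mul_inv_cancel, cp_one, ha] at this
        have h1 := congrFun this s
        simp only [Pi.zero_apply, Pi.add_apply, Function.comp_apply, inv_one,
          Equiv.Perm.one_apply] at h1
        rw [← neg_eq_of_add_eq_zero_right h1.symm]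
        exact (dvd_neg).2 (ha' s) }
  have : N.Normal := ⟨by
    rintro n ⟨hn, hn'⟩ g
    refine ⟨by rw [map_mul, map_mul, hn, map_inv, mul_one, mul_inv_cancel], fun s => ?_⟩
    have h1 := congrFun (cp_mul g g⁻¹) s
    rw [mul_inv_cancel, cp_one] at h1
    rw [cp_mul, cp_mul, map_mul, hn, mul_one]
    simp only [Pi.add_apply, Pi.zero_apply, Function.comp_apply] at h1 ⊢
    rw [add_right_comm, ← h1, zero_add]
    exact hn' _⟩
  have hle : Subgroup.normalClosure
      (Set.range fun s : S => bracket s (l * dehornoyClass S)) ≤ N := by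
    refine Subgroup.normalClosure_le_normal ?_
    rintro _ ⟨s, rfl⟩
    have h' : lam (bracket s (dehornoyClass S)) = 1 := (dehornoyClass_spec S).2 s
    refine ⟨by dsimp only; rw [bracket_mul _ _ _ h', map_pow, h', one_pow], fun t => ?_⟩
    dsimp only
    rw [cp_bracket, Pi.smul_apply, nsmul_eq_mul]
    exact dvd_mul_right _ _
  exact (hle hg).2

/-- The map `G̅_l → (ℤ/ldℤ)^S` induced by `cp`. -/
noncomputable def cpGerm [Finite S] (l : ℕ) (g : Germ S l) : S → ZMod (l * dehornoyClass S) :=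
  Quotient.lift (fun (h : StructureGroup S) s => ((cp h s : ℤ) : ZMod (l * dehornoyClass S)))
    (by
      intro a b hab
      funext s
      have hn := QuotientGroup.leftRel_apply.1 hab
      have hb : b = a * (a⁻¹ * b) := by simp
      rw [hb, cp_mul, Pi.add_apply, Int.cast_add, left_eq_add,
        Function.comp_apply, ZMod.intCast_zmod_eq_zero_iff_dvd]
      exact cp_dvd l hn _) g

/-- The reduced lift to `G` of an element of the germ: the element `∑ g_s s` of `G` above it with
`0 ≤ g_s < ld`. -/
noncomputable def germLift [Finite S] (l : ℕ) (g : Germ S l) : StructureGroup S :=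
  cpEquiv.symm fun s => ((cpGerm l g s).val : ℤ)

/-- `germLift l g` does lie above `g`. -/
theorem mk_germLift [Finite S] (l : ℕ) (hl : 0 < l) (g : Germ S l) :
    (QuotientGroup.mk (germLift l g) : Germ S l) = g := by
  classical
  have := Fintype.ofFinite S
  have hd := (dehornoyClass_spec S).1
  have : NeZero (l * dehornoyClass S) := ⟨by positivity⟩
  set n := l * dehornoyClass S with hn
  let K : AddSubgroup (S → ℤ) :=
    { carrier := {w | ∀ v, (QuotientGroup.mk (cpEquiv.symm (v + w)) : Germ S l) =
        QuotientGroup.mk (cpEquiv.symm v)}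
      zero_mem' := fun v => by rw [add_zero]
      add_mem' := fun {a b} ha hb v => by rw [← add_assoc, hb, ha]
      neg_mem' := fun {a} ha v => by rw [← ha (v + -a), neg_add_cancel_right] }
  have hK : ∀ s, (n • basisVec s : S → ℤ) ∈ K := by
    intro s v
    obtain ⟨h, rfl⟩ := cpEquiv.surjective v
    have : cpEquiv h + n • basisVec s = cpEquiv (h * bracket ((lam h)⁻¹ s) n) := by
      change cp h + _ = cp _
      rw [cp_mul, cp_bracket]
      congr 1
      rw [← basisVec_comp s (lam h)⁻¹]
      rfl
    rw [this, Equiv.symm_apply_apply, Equiv.symm_apply_apply]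
    symm
    rw [QuotientGroup.eq]
    apply Subgroup.subset_normalClosure
    exact ⟨(lam h)⁻¹ s, by simp [hn]⟩
  have hK' : ∀ w : S → ℤ, (∀ s, (n : ℤ) ∣ w s) → w ∈ K := by
    intro w hw
    rw [← Finset.univ_sum_single w]
    refine AddSubgroup.sum_mem _ fun s _ => ?_
    obtain ⟨c, hc⟩ := hw s
    have : (Pi.single s (w s) : S → ℤ) = c • (n • basisVec s) := by
      rw [hc, basisVec, ← Pi.single_smul, ← Pi.single_smul]; congr 1; simp [mul_comm]
    rw [this]
    exact AddSubgroup.zsmul_mem _ (hK s) _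
  obtain ⟨h, rfl⟩ := QuotientGroup.mk_surjective g
  have := hK' ((fun s => ((cpGerm l (h : Germ S l) s).val : ℤ)) - cp h) (fun s => by
    rw [← ZMod.intCast_zmod_eq_zero_iff_dvd]
    simp [cpGerm, hn]) (cp h)
  rw [add_sub_cancel] at this
  rw [germLift, this]
  congr 1
  exact cpEquiv.symm_apply_apply h

/-- `germLift l g` is the product in `G` of any reduced expression of `g`, that is, of any word over
`S` representing `g` of length `∑ g_s`, `0 ≤ g_s < ld`. -/
theorem germLift_of_reduced [Fintype S] (l : ℕ) (hl : 0 < l) (g : Germ S l)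
    (w : List S) (hw : (QuotientGroup.mk (w.map gen).prod : Germ S l) = g)
    (hlen : w.length = ∑ s, (cpGerm l g s).val) : germLift l g = (w.map gen).prod := by
  classical
  have hd := (dehornoyClass_spec S).1
  have : NeZero (l * dehornoyClass S) := ⟨by positivity⟩
  have key : ∀ w : List S, (∀ s, 0 ≤ cp (w.map gen).prod s) ∧
      ∑ s, cp (w.map gen).prod s = w.length := by
    intro w
    induction w with
    | nil => simp [cp_one]
    | cons a w ih =>
      simp only [List.map_cons, List.prod_cons, cp_mul, cp_gen]
      constructor
      · intro s
        have : 0 ≤ basisVec a s := by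
          rw [basisVec, Pi.single_apply]; split_ifs <;> simp
        exact add_nonneg this (ih.1 _)
      · have h1 : ∑ s, basisVec a s = 1 := by simp [basisVec]
        have h2 := Equiv.sum_comp (lam (gen a))⁻¹ (cp (w.map gen).prod)
        simp only [Pi.add_apply, Function.comp_apply, Finset.sum_add_distrib, h1, h2, ih.2]
        simp [add_comm]
  subst hw
  obtain ⟨k1, k2⟩ := key w
  apply cp_bijective.1
  have e : cp (germLift l (QuotientGroup.mk (w.map gen).prod : Germ S l)) = fun s =>
      (((cp (w.map gen).prod s : ℤ) : ZMod (l * dehornoyClass S)).val : ℤ) := cpEquiv.apply_symm_apply _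
  rw [e]
  have hle : ∀ s ∈ Finset.univ,
      (((cp (w.map gen).prod s : ℤ) : ZMod (l * dehornoyClass S)).val : ℤ) ≤ cp (w.map gen).prod s := by
    intro s _
    rw [ZMod.val_intCast]
    have h1 := Int.mul_ediv_add_emod (cp (w.map gen).prod s) (l * dehornoyClass S : ℕ)
    have h2 : 0 ≤ ((l * dehornoyClass S : ℕ) : ℤ) *
        (cp (w.map gen).prod s / ((l * dehornoyClass S : ℕ) : ℤ)) :=
      mul_nonneg (by positivity) (Int.ediv_nonneg (k1 s) (by positivity))
    linarith
  have hs := (Finset.sum_eq_sum_iff_of_le hle).1 (by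
    rw [k2, hlen]; push_cast; rfl)
  funext s
  exact hs s (Finset.mem_univ s)

end StructureGroup

section Hecke

variable (S : Type*) [CycleSet S] [Finite S] {R : Type*} [CommRing R]

/-- The two-sided ideal `J_P` of `R[G]` generated by the `P(s^{[d]})`, `s ∈ S`. -/
noncomputable def heckeIdeal (P : R[X]) : TwoSidedIdeal (MonoidAlgebra R (StructureGroup S)) :=
  TwoSidedIdeal.span (Set.range fun s : S =>
    aeval (MonoidAlgebra.of R (StructureGroup S) (bracket s (dehornoyClass S))) P)

/-- The Hecke algebra `H(S, P) = R[G] / J_P`. -/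
abbrev HeckeAlgebra (P : R[X]) : Type _ := (heckeIdeal S P).ringCon.Quotient

variable {S}

/-- The element `T_g` of `H(S, P)` attached to an element `g` of the germ `G̅_l`: the image of the
reduced lift of `g`, equivalently `T_{s₁} ⋯ T_{s_k}` for any reduced expression `s₁ ⋯ s_k` of
`g`. -/
noncomputable def heckeT (P : R[X]) (l : ℕ) (g : Germ S l) : HeckeAlgebra S P :=
  (heckeIdeal S P).ringCon.mk' (MonoidAlgebra.of R (StructureGroup S) (germLift l g))

end Hecke

end CycleSet

/-- An anti-involution of a ring `A`: an additive map with `f (x y) = f y f x` and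
`f (f x) = x`. -/
structure IsAntiInvolution {A : Type*} [Ring A] (f : A → A) : Prop where
  map_add : ∀ x y, f (x + y) = f x + f y
  map_mul : ∀ x y, f (x * y) = f y * f x
  involutive : ∀ x, f (f x) = x

/-- The polynomial `X² - (q - 1) X - q` over `R[q, q⁻¹]`. -/
noncomputable def genericHeckePoly (R : Type*) [CommRing R] : (LaurentPolynomial R)[X] :=
  X ^ 2 - C (LaurentPolynomial.T 1 - 1) * X - C (LaurentPolynomial.T 1)

open CycleSet

/-! Inversion `g ↦ g⁻¹` on `G`, combined with `ι` on scalars, is an anti-morphism from `R[G]` to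
`H(S, P)`; everything rests on its vanishing on `J_P`. Let `x` be the image of `s^{[d]}`, a unit.
The generator `P(s^{[d]})` is sent to `P^ι(x⁻¹)`, where `P^ι` has the roots `αᵢ⁻¹`. Since `x⁻¹ - α⁻¹
= -α⁻¹ x⁻¹ (x - α)`, this value is a multiple of `∏ (x - αᵢ)`
(`Polynomial.aeval_inv_prod_X_sub_C_inv`), which is zero in `H(S, P)` because the leading
coefficient is invertible (`heckeIdeal_le_ker_invHom`).

The induced anti-morphism squares to a ring endomorphism fixing the scalars and the image of `G`,
hence to the identity (`exists_antiInvolution`). Each `T_g` is the image of an element of `G`, so it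
is invertible and is sent to its inverse. The generic case is the factorisation `(X - q)(X + 1)`,
whose roots are inverted by `q ↦ q⁻¹`. -/

/-- In an algebra, the value at `x⁻¹` of the polynomial with roots `αᵢ⁻¹` is the value at `x` of the
polynomial with roots `αᵢ`, up to an invertible factor. -/
theorem Polynomial.aeval_inv_prod_X_sub_C_inv {R A J : Type*} [CommRing R] [Ring A] [Algebra R A]
    (x : Aˣ) (s : Finset J) (α : J → Rˣ) :
    aeval ((x⁻¹ : Aˣ) : A) (∏ i ∈ s, (X - C (((α i)⁻¹ : Rˣ) : R))) =
      algebraMap R A (∏ i ∈ s, -(((α i)⁻¹ : Rˣ) : R)) * ((x⁻¹ : Aˣ) : A) ^ s.card *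
        aeval (x : A) (∏ i ∈ s, (X - C ((α i : Rˣ) : R))) := by
  classical
  induction s using Finset.induction_on with
  | empty => simp
  | insert a s ha ih =>
    -- The case of one root: `x⁻¹ - α⁻¹ = -α⁻¹ x⁻¹ (x - α)`.
    have h1 : aeval ((x⁻¹ : Aˣ) : A) (X - C (((α a)⁻¹ : Rˣ) : R)) =
        algebraMap R A (-(((α a)⁻¹ : Rˣ) : R)) * ((x⁻¹ : Aˣ) : A) *
          aeval (x : A) (X - C ((α a : Rˣ) : R)) := by
      have h2 : ((x⁻¹ : Aˣ) : A) * algebraMap R A ((α a : Rˣ) : R) =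
          algebraMap R A ((α a : Rˣ) : R) * ((x⁻¹ : Aˣ) : A) := (Algebra.commutes _ _).symm
      have h3 : algebraMap R A (((α a)⁻¹ : Rˣ) : R) * algebraMap R A ((α a : Rˣ) : R) = 1 := by
        rw [← map_mul, Units.inv_mul, map_one]
      simp only [map_sub, aeval_X, aeval_C, mul_sub, mul_assoc, h2, map_neg, neg_mul,
        Units.inv_mul]
      rw [← mul_assoc (algebraMap R A _) (algebraMap R A _), h3]
      simp only [mul_one, one_mul]
      abel
    -- `A` need not be commutative, but `x - α` commutes with powers of `x⁻¹`; with the centrality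
    -- of scalars, this lets the factors `x⁻¹` be gathered on the left.
    have hc : Commute (aeval (x : A) (X - C ((α a : Rˣ) : R))) (((x⁻¹ : Aˣ) : A) ^ s.card) := by
      refine Commute.pow_right ?_ _
      simp only [map_sub, aeval_X, aeval_C]
      exact Commute.sub_left ((Commute.refl (x : A)).units_inv_right)
        (Algebra.commutes _ _)
    rw [Finset.prod_insert ha, Finset.prod_insert ha, Finset.prod_insert ha, map_mul, h1, ih,
      Finset.card_insert_of_notMem ha, pow_succ', map_mul, map_mul]
    have hd : ∀ (r : R) (y : A), y * algebraMap R A r = algebraMap R A r * y := fun r y =>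
      (Algebra.commutes r y).symm
    set p := aeval (x : A) (X - C ((α a : Rˣ) : R))
    calc _ = algebraMap R A (-(((α a)⁻¹ : Rˣ) : R)) * ((x⁻¹ : Aˣ) : A) *
          (p * algebraMap R A (∏ i ∈ s, -(((α i)⁻¹ : Rˣ) : R))) * ((x⁻¹ : Aˣ) : A) ^ s.card *
          aeval (x : A) (∏ i ∈ s, (X - C ((α i : Rˣ) : R))) := by simp only [mul_assoc]
      _ = algebraMap R A (-(((α a)⁻¹ : Rˣ) : R)) *
          (((x⁻¹ : Aˣ) : A) * algebraMap R A (∏ i ∈ s, -(((α i)⁻¹ : Rˣ) : R))) *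
          (p * ((x⁻¹ : Aˣ) : A) ^ s.card) *
          aeval (x : A) (∏ i ∈ s, (X - C ((α i : Rˣ) : R))) := by
        rw [hd _ p]; simp only [mul_assoc]
      _ = _ := by rw [hd, hc.eq]; simp only [mul_assoc]

/-! ### The anti-involution of the Hecke algebra -/

namespace CycleSet

section HeckeInvolution

variable {S : Type*} [CycleSet S] [Finite S] {R : Type*} [CommRing R]

/-- The image in `H(S, P)` of an element of the structure group. -/
noncomputable def heckeOf (P : R[X]) : StructureGroup S →* HeckeAlgebra S P :=
  ((heckeIdeal S P).ringCon.mk' : _ →* _).comp (MonoidAlgebra.of R (StructureGroup S))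

theorem heckeT_eq_heckeOf (P : R[X]) (l : ℕ) (g : Germ S l) :
    heckeT P l g = heckeOf P (germLift l g) := rfl

theorem aeval_heckeOf_bracket (P : R[X]) (s : S) :
    aeval (heckeOf P (bracket s (dehornoyClass S))) P = 0 := by
  -- The quotient map is taken as an `R`-algebra morphism so that it commutes with `aeval`.
  let π : MonoidAlgebra R (StructureGroup S) →ₐ[R] HeckeAlgebra S P :=
    { (heckeIdeal S P).ringCon.mk' with commutes' := fun _ => rfl }
  have h : π (aeval (MonoidAlgebra.of R (StructureGroup S) (bracket s (dehornoyClass S))) P) = 0 := by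
    refine (RingCon.eq _).2 ?_
    exact TwoSidedIdeal.subset_span ⟨s, rfl⟩
  rwa [← aeval_algHom_apply] at h

/-- The anti-morphism `R[G] → H(S, P)` that acts by `σ` on scalars and by `g ↦ g⁻¹` on `G`. -/
noncomputable def invHom (P : R[X]) (σ : R →+* R) :
    MonoidAlgebra R (StructureGroup S) →+* (HeckeAlgebra S P)ᵐᵒᵖ :=
  MonoidAlgebra.liftNCRingHom ((algebraMap R (HeckeAlgebra S P)ᵐᵒᵖ).comp σ)
    { toFun := fun g => MulOpposite.op (heckeOf P g⁻¹)
      map_one' := by simp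
      map_mul' := fun g h => by rw [mul_inv_rev, map_mul, MulOpposite.op_mul] }
    fun r _ => Algebra.commute_algebraMap_left (σ r) _

theorem invHom_of (P : R[X]) (σ : R →+* R) (g : StructureGroup S) :
    invHom P σ (MonoidAlgebra.of R _ g) = MulOpposite.op (heckeOf P g⁻¹) := by
  simp [invHom]

theorem invHom_algebraMap (P : R[X]) (σ : R →+* R) (r : R) :
    invHom P σ (algebraMap R (MonoidAlgebra R (StructureGroup S)) r) =
      MulOpposite.op (algebraMap R (HeckeAlgebra S P) (σ r)) := by
  simp [invHom]

/-- Reversing products is harmless here: powers of a single element commute with each other, and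
coefficients are central. -/
theorem invHom_aeval_of (P : R[X]) (σ : R →+* R) (g : StructureGroup S) (Q : R[X]) :
    invHom P σ (aeval (MonoidAlgebra.of R _ g) Q) =
      MulOpposite.op (aeval (heckeOf P g⁻¹) (Q.map σ)) := by
  induction Q using Polynomial.induction_on' with
  | add p q hp hq => simp only [map_add, hp, hq, Polynomial.map_add, MulOpposite.op_add]
  | monomial n r =>
    rw [Polynomial.map_monomial, aeval_monomial, aeval_monomial, map_mul, map_pow, invHom_of,
      invHom_algebraMap, ← MulOpposite.op_pow, ← MulOpposite.op_mul, Algebra.commutes]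

/-- The kernel is a two-sided ideal, so only the generators `P(s^{[d]})` matter; for these,
inverting the roots and the variable together multiplies the vanishing product `∏ (x - αᵢ)` by some
factor. -/
theorem heckeIdeal_le_ker_invHom {J : Type*} [Fintype J] (P : R[X]) (σ : R →+* R) (a : Rˣ)
    (α : J → Rˣ) (hP : P = C (a : R) * ∏ i, (X - C (α i : R)))
    (hσ : ∀ i, σ (α i) = ((α i)⁻¹ : Rˣ)) :
    (heckeIdeal S P).ringCon ≤ RingCon.ker (invHom (S := S) P σ) := by
  have hle : heckeIdeal S P ≤ TwoSidedIdeal.ker (invHom (S := S) P σ) := by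
    refine TwoSidedIdeal.span_le.2 ?_
    rintro _ ⟨s, rfl⟩
    rw [SetLike.mem_coe, TwoSidedIdeal.mem_ker, invHom_aeval_of]
    set g := bracket s (dehornoyClass S)
    let x : (HeckeAlgebra S P)ˣ := Units.map (heckeOf P) (toUnits g)
    have h0 : aeval (x : HeckeAlgebra S P) (∏ i, (X - C (α i : R))) = 0 := by
      have h1 : aeval (x : HeckeAlgebra S P) P = 0 := aeval_heckeOf_bracket P s
      -- `P` also occurs in the type `HeckeAlgebra S P`, so only the polynomial argument is
      -- rewritten.
      conv at h1 => enter [1, 2]; rw [hP]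
      rw [map_mul, aeval_C] at h1
      exact ((a.isUnit.map (algebraMap R (HeckeAlgebra S P))).mul_right_eq_zero).1 h1
    have h2 : P.map σ = C (σ a) * ∏ i, (X - C (((α i)⁻¹ : Rˣ) : R)) := by
      rw [hP, Polynomial.map_mul, Polynomial.map_prod, Polynomial.map_C]
      simp only [Polynomial.map_sub, Polynomial.map_X, Polynomial.map_C, hσ]
    have h3 : heckeOf P g⁻¹ = ((x⁻¹ : (HeckeAlgebra S P)ˣ) : HeckeAlgebra S P) := rfl
    rw [h2, h3, map_mul, aeval_inv_prod_X_sub_C_inv, h0, mul_zero, mul_zero, MulOpposite.op_zero]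
  -- From ideals to congruences: two elements are related exactly when their difference lies in the
  -- ideal.
  intro x y h
  have := hle ((TwoSidedIdeal.rel_iff _ x y).1 h)
  rwa [TwoSidedIdeal.mem_ker, map_sub, sub_eq_zero] at this

/-- As a quotient of `R[G]`, the ring `H(S, P)` is generated by the scalars and the image of `G`. -/
theorem heckeAlgebra_ringHom_ext {P : R[X]} {B : Type*} [Ring B] {f g : HeckeAlgebra S P →+* B}
    (h₁ : ∀ r : R, f (algebraMap R _ r) = g (algebraMap R _ r))
    (h₂ : ∀ x : StructureGroup S, f (heckeOf P x) = g (heckeOf P x)) : f = g := by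
  have h : f.comp (heckeIdeal S P).ringCon.mk' = g.comp (heckeIdeal S P).ringCon.mk' :=
    MonoidAlgebra.ringHom_ext h₁ h₂
  refine RingHom.ext fun x => ?_
  obtain ⟨y, rfl⟩ := RingCon.mk'_surjective _ x
  exact RingHom.congr_fun h y

/-- An involution of the ring of scalars that inverts the roots of `P` extends to an anti-involution
of `H(S, P)` that inverts the image of the structure group. -/
theorem exists_antiInvolution {J : Type*} [Fintype J] (P : R[X]) (σ : R →+* R)
    (hσσ : ∀ r, σ (σ r) = r) (a : Rˣ) (α : J → Rˣ)
    (hP : P = C (a : R) * ∏ i, (X - C (α i : R))) (hσ : ∀ i, σ (α i) = ((α i)⁻¹ : Rˣ)) :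
    ∃ τ : HeckeAlgebra S P → HeckeAlgebra S P, IsAntiInvolution τ ∧
      (∀ r : R, τ (algebraMap R _ r) = algebraMap R _ (σ r)) ∧
      ∀ g : StructureGroup S, τ (heckeOf P g) = heckeOf P g⁻¹ := by
  let Φ : HeckeAlgebra S P →+* (HeckeAlgebra S P)ᵐᵒᵖ :=
    (heckeIdeal S P).ringCon.lift (invHom P σ) (heckeIdeal_le_ker_invHom P σ a α hP hσ)
  have hΦr : ∀ r : R, Φ (algebraMap R _ r) = MulOpposite.op (algebraMap R _ (σ r)) := invHom_algebraMap P σ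
  have hΦg : ∀ g : StructureGroup S, Φ (heckeOf P g) = MulOpposite.op (heckeOf P g⁻¹) := invHom_of P σ
  -- Reversing products twice preserves them, so the square of the anti-morphism is a ring
  -- endomorphism and can be compared with the identity on generators.
  let Ψ : HeckeAlgebra S P →+* HeckeAlgebra S P :=
    { toFun := fun x => MulOpposite.unop (Φ (MulOpposite.unop (Φ x)))
      map_one' := by simp
      map_mul' := by simp
      map_zero' := by simp
      map_add' := by simp }
  have hΨ : Ψ = RingHom.id _ := by
    refine heckeAlgebra_ringHom_ext (fun r => ?_) fun g => ?_
    · change MulOpposite.unop (Φ (MulOpposite.unop (Φ _))) = _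
      rw [hΦr, MulOpposite.unop_op, hΦr, MulOpposite.unop_op, hσσ, RingHom.id_apply]
    · change MulOpposite.unop (Φ (MulOpposite.unop (Φ _))) = _
      rw [hΦg, MulOpposite.unop_op, hΦg, MulOpposite.unop_op, inv_inv, RingHom.id_apply]
  refine ⟨fun x => MulOpposite.unop (Φ x), ⟨fun x y => ?_, fun x y => ?_, RingHom.congr_fun hΨ⟩,
    fun r => ?_, fun g => ?_⟩
  · rw [map_add, MulOpposite.unop_add]
  · rw [map_mul, MulOpposite.unop_mul]
  · exact congrArg MulOpposite.unop (hΦr r)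
  · exact congrArg MulOpposite.unop (hΦg g)

end HeckeInvolution

end CycleSet

/-! ### Scalars, the generic polynomial and the main theorem -/

/-- An anti-involution of a commutative ring is a ring morphism. -/
def IsAntiInvolution.toRingHom {R : Type*} [CommRing R] {ι : R → R} (h : IsAntiInvolution ι) :
    R →+* R :=
  -- In `ι (ι 1 * 1) = ι 1 * ι (ι 1)` the left side is `1` and the right side is `ι 1`.
  RingHom.mk' ⟨⟨ι, by simpa [h.involutive] using (h.map_mul (ι 1) 1).symm⟩,
    fun x y => (h.map_mul x y).trans (mul_comm _ _)⟩ h.map_add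

/-- This is `(X - q)(X + 1)`, with the unit roots `q` and `-1` and leading coefficient `1`, the form
that `exists_antiInvolution` requires. -/
theorem genericHeckePoly_eq_prod (R : Type*) [CommRing R] (q : (LaurentPolynomial R)ˣ)
    (hq : (q : LaurentPolynomial R) = LaurentPolynomial.T 1) :
    genericHeckePoly R = C ((1 : (LaurentPolynomial R)ˣ) : LaurentPolynomial R) *
      ∏ i : Fin 2, (X - C ((![q, -1] i : (LaurentPolynomial R)ˣ) : LaurentPolynomial R)) := by
  simp only [genericHeckePoly, Fin.prod_univ_two, Matrix.cons_val_zero, Matrix.cons_val_one,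
    Units.val_neg, Units.val_one, map_neg, map_one, map_sub, hq]
  ring

theorem mainTheorem2 {S : Type*} [CycleSet S] [Finite S] {R : Type*} [CommRing R] :
    (∀ (P : R[X]) (l : ℕ), P.natDegree = l → 0 < l → IsUnit P.leadingCoeff →
      ∀ α : Fin l → Rˣ, P = C P.leadingCoeff * ∏ i, (X - C (α i : R)) →
      ∀ ι : R → R, IsAntiInvolution ι → (∀ i, ι (α i) = ((α i)⁻¹ : Rˣ)) →
      ∃ ι' : HeckeAlgebra S P → HeckeAlgebra S P,
        IsAntiInvolution ι' ∧
        (∀ r : R, ι' (algebraMap R _ r) = algebraMap R _ (ι r)) ∧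
        ∀ g : Germ S l, ι' (heckeT P l g) * heckeT P l g = 1 ∧
          heckeT P l g * ι' (heckeT P l g) = 1) ∧
    (∃ ι' : HeckeAlgebra S (genericHeckePoly R) → HeckeAlgebra S (genericHeckePoly R),
      IsAntiInvolution ι' ∧
      (∀ r : LaurentPolynomial R, ι' (algebraMap (LaurentPolynomial R) _ r) =
        algebraMap (LaurentPolynomial R) _ (LaurentPolynomial.invert r)) ∧
      ∀ g : Germ S 2, ι' (heckeT (genericHeckePoly R) 2 g) * heckeT (genericHeckePoly R) 2 g = 1 ∧
        heckeT (genericHeckePoly R) 2 g * ι' (heckeT (genericHeckePoly R) 2 g) = 1) := by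
  refine ⟨?_, ?_⟩
  · intro P l _ _ hu α hP ι hι hα
    obtain ⟨a, ha⟩ := hu
    obtain ⟨τ, h1, h2, h3⟩ := exists_antiInvolution (S := S) P hι.toRingHom hι.involutive a α
      (by rw [ha]; exact hP) hα
    refine ⟨τ, h1, h2, fun g => ?_⟩
    -- `T_g` comes from an element of `G`, so both products are images of `1`.
    rw [heckeT_eq_heckeOf, h3, ← map_mul, ← map_mul, inv_mul_cancel, mul_inv_cancel, map_one]
    exact ⟨rfl, rfl⟩
  · let q : (LaurentPolynomial R)ˣ :=
      ⟨LaurentPolynomial.T 1, LaurentPolynomial.T (-1),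
        by rw [← LaurentPolynomial.T_add]; simp, by rw [← LaurentPolynomial.T_add]; simp⟩
    obtain ⟨τ, h1, h2, h3⟩ := exists_antiInvolution (S := S) (genericHeckePoly R)
      (LaurentPolynomial.invert (R := R)).toRingEquiv.toRingHom
      LaurentPolynomial.involutive_invert 1 ![q, -1] (genericHeckePoly_eq_prod R q rfl) (by
        intro i
        -- The root `q` is sent to `q⁻¹`; the root `-1` is fixed and is its own inverse.
        fin_cases i
        · exact LaurentPolynomial.invert_T 1
        · simp)
    refine ⟨τ, h1, h2, fun g => ?_⟩
    rw [heckeT_eq_heckeOf, h3, ← map_mul, ← map_mul, inv_mul_cancel, mul_inv_cancel, map_one]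
    exact ⟨rfl, rfl⟩
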